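/- Let $M\in\mathbb R$, $\delta>0$, $q>1$, $T>0$, and set $p=\frac{q}{q-1}$. There is a constant $\theta=\theta(M,\delta,q,T)>p$ and, for every $\tau>0$, a constant $K_\tau=K(\tau,M,\delta,q,T)$ such that the following holds. Let $N$ be any dimension, let $b:\mathbb R^N\times(0,T)\to\mathbb R$, $f:\mathbb R^N\times(0,T)\to\mathbb R^N$ and $g:\mathbb R^N\to\mathbb R$ be continuous and bounded by $M$, with $b(x,t)\ge\delta$ for all $(x,t)\in\mathbb R^N\times(0,T)$, and let $u:\mathbb R^N\times[0,T]\to\mathbb R$ be a continuous viscosity solution of $$ \begin{cases} -u_t(x,t)+b(x,t)|Du(x,t)|^q+f(x,t)\cdot Du(x,t)=0 & \text{in } \mathbb R^N\times(0,T),\\ u(x,T)=g(x) & \text{for } x\in\mathbb R^N . \end{cases} $$ Then for all $x_0,x_1\in\mathbb R^N$ and all $t_0,t_1\in[0,T-\tau]$, $$ |u(x_0,t_0)-u(x_1,t_1)|\le K_\tau\left(|x_0-x_1|^{(\theta-p)/(\theta-1)}+|t_0-t_1|^{(\theta-p)/\theta}\right). $$ In particular, $u$ is locally Hölder continuous in space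 and time in $\mathbb R^N\times[0,T)$, with exponents and constants that do not depend on the smoothness of $b$, $f$, $g$. -/

import Mathlib

namespace HJ

/-- The space `ℝ^N` with its Euclidean norm. -/
abbrev Space (N : ℕ) : Type := EuclideanSpace ℝ (Fin N)

/-- The Hamiltonian `H(x, t, ξ) = b(x, t) |ξ|^q + f(x, t) · ξ`. -/
noncomputable def hamiltonian {N : ℕ} (q : ℝ) (b : Space N → ℝ → ℝ) (f : Space N → ℝ → Space N)
    (x : Space N) (t : ℝ) (ξ : Space N) : ℝ :=
  b x t * ‖ξ‖ ^ q + inner ℝ (f x t) ξ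

/-- The left-hand side `-φ_t + b |Dφ|^q + f · Dφ` of the equation, evaluated at `(x, t)` on a
differentiable function `φ` of `(x, t)`. -/
noncomputable def hjOperator {N : ℕ} (q : ℝ) (b : Space N → ℝ → ℝ) (f : Space N → ℝ → Space N)
    (φ : Space N × ℝ → ℝ) (x : Space N) (t : ℝ) : ℝ :=
  -deriv (fun s : ℝ => φ (x, s)) t + hamiltonian q b f x t (gradient (fun y : Space N => φ (y, t)) x)

/-- Viscosity subsolution of `-u_t + b |Du|^q + f · Du = 0` in `ℝ^N × (0, T)`: the inequality `≤ 0`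
holds for every `C¹` test function at each interior local maximum point of `u - φ`. -/
def IsViscositySubsolution {N : ℕ} (q T : ℝ) (b : Space N → ℝ → ℝ) (f : Space N → ℝ → Space N)
    (u : Space N → ℝ → ℝ) : Prop :=
  ∀ φ : Space N × ℝ → ℝ, ContDiff ℝ 1 φ → ∀ (x : Space N) (t : ℝ), t ∈ Set.Ioo 0 T →
    IsLocalMax (fun z : Space N × ℝ => u z.1 z.2 - φ z) (x, t) → hjOperator q b f φ x t ≤ 0

/-- Viscosity supersolution of `-u_t + b |Du|^q + f · Du = 0` in `ℝ^N × (0, T)`: the inequality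
`≥ 0` holds for every `C¹` test function at each interior local minimum point of `u - φ`. -/
def IsViscositySupersolution {N : ℕ} (q T : ℝ) (b : Space N → ℝ → ℝ) (f : Space N → ℝ → Space N)
    (u : Space N → ℝ → ℝ) : Prop :=
  ∀ φ : Space N × ℝ → ℝ, ContDiff ℝ 1 φ → ∀ (x : Space N) (t : ℝ), t ∈ Set.Ioo 0 T →
    IsLocalMin (fun z : Space N × ℝ => u z.1 z.2 - φ z) (x, t) → 0 ≤ hjOperator q b f φ x t

/-- `u` is a (continuous) viscosity solution of the terminal value problem
`-u_t + b |Du|^q + f · Du = 0` in `ℝ^N × (0, T)`, `u(·, T) = g` on `ℝ^N`.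
The values of `u` outside `ℝ^N × [0, T]` play no role. -/
structure IsSolution {N : ℕ} (q T : ℝ) (b : Space N → ℝ → ℝ) (f : Space N → ℝ → Space N)
    (g : Space N → ℝ) (u : Space N → ℝ → ℝ) : Prop where
  continuousOn : ContinuousOn (fun z : Space N × ℝ => u z.1 z.2) (Set.univ ×ˢ Set.Icc 0 T)
  subsolution : IsViscositySubsolution q T b f u
  supersolution : IsViscositySupersolution q T b f u
  terminal : ∀ x : Space N, u x T = g x

/-- The standing assumptions on the data: `b`, `f` (on `ℝ^N × (0, T)`) and `g` (on `ℝ^N`) are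
continuous and bounded by `M`, and `b ≥ δ` on `ℝ^N × (0, T)`. -/
structure Admissible {N : ℕ} (M δ T : ℝ) (b : Space N → ℝ → ℝ) (f : Space N → ℝ → Space N)
    (g : Space N → ℝ) : Prop where
  continuousOn_b : ContinuousOn (fun z : Space N × ℝ => b z.1 z.2) (Set.univ ×ˢ Set.Ioo 0 T)
  continuousOn_f : ContinuousOn (fun z : Space N × ℝ => f z.1 z.2) (Set.univ ×ˢ Set.Ioo 0 T)
  continuous_g : Continuous g
  abs_b_le : ∀ (x : Space N), ∀ t ∈ Set.Ioo 0 T, |b x t| ≤ M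
  norm_f_le : ∀ (x : Space N), ∀ t ∈ Set.Ioo 0 T, ‖f x t‖ ≤ M
  abs_g_le : ∀ x : Space N, |g x| ≤ M
  le_b : ∀ (x : Space N), ∀ t ∈ Set.Ioo 0 T, δ ≤ b x t

end HJ

/-! By convex duality, a Hamiltonian of growth `q` corresponds to a control problem whose running
cost is the `p`-th power of the speed. No representation formula is used, only its trace in
`ActionBounds`: every displacement bounds the increments of `u` from above with a constant `A`, and
some displacement realises a lower bound with a constant `c`, both up to a drift `B`. These
constants depend on `M`, `δ`, `q` only, not on the dimension or on moduli of continuity of the data.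

Regularity follows from these two bounds alone. Along an almost optimal displacement, comparison
with a direct one gives a hole-filling inequality (`ActionBounds.excess_le`): the action spent on a
short initial interval is at most a fixed fraction of that spent on a longer one, up to drift.
Iteration yields action at most `L * h ^ β` (`exists_decay_exponent`), so displacements are of order
`h ^ γ` with `γ > (p - 1) / p`. This gain over the natural scaling becomes Hölder continuity when a
neighbouring point is sent to the same endpoint (`exists_holder_exponent`).

The upper bound comes from the subsolution property along straight lines and Young's inequality. The
lower bound comes from a barrier for the supersolution in a unit cylinder (`exists_exit`). Exits are
chained until the final time, and the upper bound rules out infinite chains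
(`not_exists_unit_chain`). Neither a comparison principle nor a growth assumption on `u` is needed.
-/

namespace HJ

/-! ### The `p`-action of a displacement. -/

/-- The minimal `p`-action `h (d / h) ^ p` needed to cover the distance `d` in time `h`. -/
noncomputable def cost (p d h : ℝ) : ℝ := h * (d / h) ^ p

theorem cost_nonneg {p d h : ℝ} (hd : 0 ≤ d) (hh : 0 ≤ h) : 0 ≤ cost p d h := by
  unfold cost; positivity

theorem cost_zero {p h : ℝ} (hp : 0 < p) : cost p 0 h = 0 := by
  simp [cost, Real.zero_rpow hp.ne']

theorem cost_mono {p d e h : ℝ} (hp : 0 ≤ p) (hd : 0 ≤ d) (hde : d ≤ e) (hh : 0 ≤ h) :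
    cost p d h ≤ cost p e h := by
  unfold cost; gcongr

theorem cost_eq {p d h : ℝ} (hd : 0 ≤ d) (hh : 0 < h) : cost p d h = d ^ p * h ^ (1 - p) := by
  unfold cost
  rw [Real.div_rpow hd hh.le, Real.rpow_sub hh, Real.rpow_one]
  ring

theorem cost_scale {p d h k : ℝ} (hd : 0 ≤ d) (hh : 0 < h) (hk : 0 < k) :
    cost p d h = k ^ (p - 1) * cost p d (k * h) := by
  rw [cost_eq hd hh, cost_eq hd (mul_pos hk hh), Real.mul_rpow hk.le hh.le]
  have : k ^ (p - 1) * k ^ (1 - p) = 1 := by rw [← Real.rpow_add hk]; simp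
  linear_combination (-(d ^ p * h ^ (1 - p))) * this

theorem cost_antitone {p d h k : ℝ} (hp : 1 ≤ p) (hd : 0 ≤ d) (hh : 0 < h) (hhk : h ≤ k) :
    cost p d k ≤ cost p d h := by
  rw [cost_eq hd hh, cost_eq hd (hh.trans_le hhk)]
  exact mul_le_mul_of_nonneg_left
    (Real.rpow_le_rpow_of_nonpos hh hhk (by linarith)) (by positivity)

/-- Jensen's inequality for `r ↦ r ^ p` with weights `s / (s + t)` and `t / (s + t)`: constant speed
is cheapest. -/
theorem cost_add_le {p a b s t : ℝ} (hp : 1 ≤ p) (ha : 0 ≤ a) (hb : 0 ≤ b) (hs : 0 < s)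
    (ht : 0 < t) : cost p (a + b) (s + t) ≤ cost p a s + cost p b t := by
  have h := (convexOn_rpow hp).2 (show a / s ∈ Set.Ici 0 from div_nonneg ha hs.le)
    (show b / t ∈ Set.Ici 0 from div_nonneg hb ht.le)
    (show 0 ≤ s / (s + t) by positivity) (show 0 ≤ t / (s + t) by positivity) (by field_simp)
  simp only [smul_eq_mul] at h
  have e : s / (s + t) * (a / s) + t / (s + t) * (b / t) = (a + b) / (s + t) := by field_simp
  rw [e] at h
  unfold cost
  calc (s + t) * ((a + b) / (s + t)) ^ p
      ≤ (s + t) * (s / (s + t) * (a / s) ^ p + t / (s + t) * (b / t) ^ p) := by gcongr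
    _ = _ := by field_simp

theorem add_rpow_le {p a b : ℝ} (hp : 1 ≤ p) (ha : 0 ≤ a) (hb : 0 ≤ b) :
    (a + b) ^ p ≤ 2 ^ (p - 1) * (a ^ p + b ^ p) := by
  have h := cost_add_le hp ha hb one_pos one_pos
  rw [cost_eq (add_nonneg ha hb) (by norm_num), cost_eq ha one_pos, cost_eq hb one_pos] at h
  norm_num at h
  have e : (2 : ℝ) ^ (p - 1) * 2 ^ (1 - p) = 1 := by
    rw [← Real.rpow_add two_pos]; simp
  calc (a + b) ^ p = 2 ^ (p - 1) * ((a + b) ^ p * 2 ^ (1 - p)) := by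
        linear_combination (-(a + b) ^ p) * e
    _ ≤ _ := by gcongr

/-! ### Action bounds and hole filling. -/

/-- Two-sided comparison of `u` with the `p`-action: the increments of `u` are controlled from
above by the cost of any displacement, and from below along some displacement. -/
structure ActionBounds {E : Type*} [NormedAddCommGroup E] (p A c B T : ℝ) (u : E → ℝ → ℝ) :
    Prop where
  upper : ∀ x y : E, ∀ t s : ℝ, 0 ≤ t → t < s → s ≤ T →
    u x t ≤ u y s + A * cost p ‖y - x‖ (s - t) + B * (s - t)
  lower : ∀ x : E, ∀ t s : ℝ, 0 ≤ t → t < s → s ≤ T →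
    ∃ y : E, u y s + c * cost p ‖y - x‖ (s - t) - B * (s - t) ≤ u x t

/-- Comparison with time `T`: stay put in the upper bound, drop the nonnegative cost in the lower
one. -/
theorem ActionBounds.abs_apply_le {E : Type*} [NormedAddCommGroup E] {p A c B T M : ℝ} {u : E → ℝ → ℝ}
    (hu : ActionBounds p A c B T u) (hp : 1 < p) (hc : 0 ≤ c) (hB : 0 ≤ B)
    (hT : ∀ x, |u x T| ≤ M) (x : E) {t : ℝ} (ht : t ∈ Set.Icc 0 T) : |u x t| ≤ M + B * T := by
  rcases ht.2.eq_or_lt with rfl | h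
  · have := hT x
    nlinarith [ht.1]
  have h1 := hu.upper x x t T ht.1 h le_rfl
  obtain ⟨y, h2⟩ := hu.lower x t T ht.1 h le_rfl
  rw [sub_self, norm_zero, cost_zero (by linarith)] at h1
  have h3 : 0 ≤ c * cost p ‖y - x‖ (T - t) :=
    mul_nonneg hc (cost_nonneg (norm_nonneg _) (by linarith))
  have h4 := abs_le.1 (hT x)
  have h5 := abs_le.1 (hT y)
  have h6 : B * (T - t) ≤ B * T := by nlinarith [ht.1]
  rw [abs_le]
  constructor <;> linarith

/-- One step of the hole-filling argument. -/
theorem ActionBounds.excess_le {E : Type*} [NormedAddCommGroup E] {p A c B T : ℝ} {u : E → ℝ → ℝ}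
    (hu : ActionBounds p A c B T u) (hp : 1 < p) (hA : 0 ≤ A) (hc : 0 < c) (hB : 0 ≤ B)
    {G ε : ℝ} (hG1 : 1 ≤ G) (hG : A / c * 2 ^ (p - 1) ≤ G) (hε : 0 < ε) (hε1 : ε < 1)
    (hGε : G * ε ^ (p - 1) ≤ 1 / 2) {x y : E} {t h : ℝ} (ht : 0 ≤ t) (hh : 0 < h)
    (hhT : t + h / ε ≤ T)
    (hy : c * cost p ‖y - x‖ h ≤ u x t - u y (t + h) + B * h) :
    ∃ y' : E, c * cost p ‖y' - x‖ (h / ε) ≤ u x t - u y' (t + h / ε) + B * (h / ε) ∧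
      u x t - u y (t + h) + B * h ≤
        (1 - 1 / (2 * G)) * (u x t - u y' (t + h / ε) + B * (h / ε)) + 2 * B * (h / ε) := by
  set k := h / ε with hk
  have hkh : h = ε * k := by rw [hk]; field_simp
  have hk0 : 0 < k := by positivity
  have hlt : h < k := by rw [hkh]; nlinarith
  -- The displacement is prolonged from `y`, not restarted at `x`, so the excess `D'` dominates `D`
  -- plus the action of the second leg.
  obtain ⟨y', hy'⟩ := hu.lower y (t + h) (t + k) (by linarith) (by linarith) hhT
  have hup := hu.upper x y' t (t + k) ht (by linarith) hhT
  rw [show t + k - (t + h) = k - h by ring] at hy'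
  rw [show t + k - t = k by ring] at hup
  set D := u x t - u y (t + h) + B * h with hD
  set D' := u x t - u y' (t + k) + B * k with hD'
  have h1 : D + c * cost p ‖y' - y‖ (k - h) ≤ D' := by
    rw [hD, hD']; linarith
  have htri : ‖y' - x‖ ≤ ‖y - x‖ + ‖y' - y‖ := by
    have := norm_add_le (y - x) (y' - y)
    rwa [show y - x + (y' - y) = y' - x by abel] at this
  refine ⟨y', ?_, ?_⟩
  · have := cost_add_le hp.le (norm_nonneg (y - x)) (norm_nonneg (y' - y)) hh (sub_pos.2 hlt)
    rw [show h + (k - h) = k by ring] at this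
    have h2 := cost_mono (p := p) (by linarith) (norm_nonneg _) htri hk0.le
    calc c * cost p ‖y' - x‖ k ≤ c * (cost p ‖y - x‖ h + cost p ‖y' - y‖ (k - h)) := by
          gcongr; exact h2.trans this
      _ ≤ _ := by linarith
  -- Stretching the first leg from time `h = ε * k` to time `k` multiplies its cost by `ε ^ (p -
  -- 1)`; this small factor is the gain.
  · have hS : cost p ‖y' - x‖ k ≤ 2 ^ (p - 1) *
        (ε ^ (p - 1) * cost p ‖y - x‖ h + cost p ‖y' - y‖ (k - h)) := by
      have h2 := cost_mono (p := p) (by linarith) (norm_nonneg _) htri hk0.le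
      refine h2.trans ?_
      have h3 := cost_scale (p := p) (norm_nonneg (y - x)) hk0 hε
      rw [← hkh] at h3
      have h4 := cost_antitone hp.le (norm_nonneg (y' - y)) (sub_pos.2 hlt)
        (show k - h ≤ k by linarith)
      rw [← h3]
      calc cost p (‖y - x‖ + ‖y' - y‖) k
          ≤ 2 ^ (p - 1) * (cost p ‖y - x‖ k + cost p ‖y' - y‖ k) := by
            rw [cost_eq (by positivity) hk0, cost_eq (by positivity) hk0,
              cost_eq (by positivity) hk0, ← add_mul, ← mul_assoc]
            gcongr
            exact add_rpow_le hp.le (norm_nonneg _) (norm_nonneg _)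
        _ ≤ _ := by gcongr
    have hε' : 0 < ε ^ (p - 1) := by positivity
    have hD0 : 0 ≤ D := le_trans (mul_nonneg hc.le (cost_nonneg (norm_nonneg _) hh.le)) hy
    have hDD' : D ≤ D' := by
      have := mul_nonneg hc.le
        (cost_nonneg (p := p) (norm_nonneg (y' - y)) (sub_pos.2 hlt).le)
      linarith
    have h5 : A * cost p ‖y' - x‖ k ≤ G * (ε ^ (p - 1) * D + (D' - D)) := by
      calc A * cost p ‖y' - x‖ k ≤ A * (2 ^ (p - 1) *
            (ε ^ (p - 1) * cost p ‖y - x‖ h + cost p ‖y' - y‖ (k - h))) := by gcongr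
        _ = A / c * 2 ^ (p - 1) * (ε ^ (p - 1) * (c * cost p ‖y - x‖ h) +
            c * cost p ‖y' - y‖ (k - h)) := by field_simp
        _ ≤ A / c * 2 ^ (p - 1) * (ε ^ (p - 1) * D + (D' - D)) := by
            gcongr
            linarith
        _ ≤ _ := by
            gcongr ?_ * _
    -- Hole filling: the upper bound gives `D' ≤ D / 2 + G * (D' - D) + 2 * B * k`. Move `G * D` to
    -- the left and use `D ≤ D'`.
    have h6 : G * D ≤ (G - 1 / 2) * D' + 2 * B * k := by
      have h7 : G * (ε ^ (p - 1) * D) ≤ 1 / 2 * D := by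
        rw [← mul_assoc]; gcongr
      have h8 : D' ≤ A * cost p ‖y' - x‖ k + 2 * B * k := by rw [hD']; linarith
      nlinarith
    have hG0 : 0 < G := by linarith
    have h9 : D ≤ ((G - 1 / 2) * D' + 2 * B * k) / G := by
      rw [le_div_iff₀ hG0]; linarith
    refine h9.trans ?_
    have h10 : 2 * B * k / G ≤ 2 * B * k := div_le_self (by positivity) hG1
    calc _ = (1 - 1 / (2 * G)) * D' + 2 * B * k / G := by field_simp
      _ ≤ _ := by linarith

/-- Power decay of the action along suitable displacements. -/
theorem exists_decay_exponent {p A c : ℝ} (hp : 1 < p) (hA : 0 ≤ A) (hc : 0 < c) :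
    ∃ β : ℝ, 0 < β ∧ β < 1 ∧ ∀ B C T τ : ℝ, 0 ≤ B → 0 ≤ C → 0 < T → 0 < τ → ∃ L : ℝ, 0 < L ∧
      ∀ (E : Type) [NormedAddCommGroup E] (u : E → ℝ → ℝ), ActionBounds p A c B T u →
        (∀ x, ∀ t ∈ Set.Icc 0 T, |u x t| ≤ C) →
        ∀ (x : E) (t h : ℝ), 0 ≤ t → t + τ ≤ T → 0 < h → t + h ≤ T →
          ∃ y : E, c * cost p ‖y - x‖ h ≤ L * h ^ β ∧ u y (t + h) ≤ u x t + B * h := by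
  set G := max 1 (A / c * 2 ^ (p - 1)) with hGdef
  have hG1 : 1 ≤ G := le_max_left _ _
  have hG : A / c * 2 ^ (p - 1) ≤ G := le_max_right _ _
  have hG0 : 0 < G := by linarith
  set ε := (1 / (2 * G)) ^ (1 / (p - 1)) with hεdef
  have hε : 0 < ε := by positivity
  have hp1 : 0 < p - 1 := by linarith
  have hG2 : 1 / (2 * G) ≤ 1 / 2 := by
    apply one_div_le_one_div_of_le <;> linarith
  have hG3 : 0 < 1 / (2 * G) := by positivity
  have hε1 : ε < 1 := Real.rpow_lt_one hG3.le (by linarith) (by positivity)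
  have hGε : G * ε ^ (p - 1) ≤ 1 / 2 := by
    rw [hεdef, ← Real.rpow_mul hG3.le, one_div_mul_cancel hp1.ne', Real.rpow_one]
    field_simp; norm_num
  set lam := 1 - 1 / (2 * G) with hlam
  have hl0 : 0 < lam := by linarith
  have hl1 : lam < 1 := by linarith
  -- Without drift `lam ≤ ε ^ β` would suffice; the square root leaves a factor `1 - √lam` to absorb
  -- it. The choice involves only `p`, `A`, `c`.
  obtain ⟨β, hβε, hβ0, hβ1⟩ : ∃ β : ℝ, √lam < ε ^ β ∧ 0 < β ∧ β < 1 := by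
    have h1 : Filter.Tendsto (fun β : ℝ => ε ^ β) (nhds 0) (nhds 1) := by
      have := (Real.continuous_const_rpow hε.ne').tendsto 0
      simpa using this
    have h2 : √lam < 1 := by
      rw [Real.sqrt_lt' one_pos]; linarith
    have h3 := (h1.eventually (lt_mem_nhds h2)).filter_mono
      (nhdsWithin_le_nhds (s := Set.Ioi (0 : ℝ)))
    have h4 : Set.Ioo (0 : ℝ) 1 ∈ nhdsWithin (0 : ℝ) (Set.Ioi 0) :=
      Ioo_mem_nhdsGT one_pos
    obtain ⟨β, hb, hb'⟩ := (h3.and h4).exists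
    exact ⟨β, hb, hb'.1, hb'.2⟩
  refine ⟨β, hβ0, hβ1, fun B C T τ hB hC hT hτ => ?_⟩
  have hsq : √lam < 1 := by
    rw [Real.sqrt_lt' one_pos]; linarith
  have hsq0 : 0 < 1 - √lam := by linarith
  -- The first summand absorbs the drift at each scale, the second covers `h > ε * τ`, where the
  -- excess is at most `2 * C + B * T`, and the third makes `L` positive.
  set L := 2 * B * T ^ (1 - β) / ε / (1 - √lam) + (2 * C + B * T) / (ε * τ) ^ β + 1 with hL
  have hL1 : 2 * B * T ^ (1 - β) / ε ≤ L * (1 - √lam) := by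
    rw [← div_le_iff₀ hsq0, hL]
    have : 0 ≤ (2 * C + B * T) / (ε * τ) ^ β := by positivity
    linarith
  have hL2 : 2 * C + B * T ≤ L * (ε * τ) ^ β := by
    rw [← div_le_iff₀ (by positivity), hL]
    have : 0 ≤ 2 * B * T ^ (1 - β) / ε / (1 - √lam) := by positivity
    linarith
  have hL0 : 0 < L := by positivity
  refine ⟨L, hL0, fun E _ u hu hub x t h ht htτ hh hhT => ?_⟩
  -- Induction on the number of dilations by `1 / ε` needed to reach the scale `T - t`. The endpoint
  -- is quantified because each dilation replaces it.
  have key : ∀ k : ℕ, ∀ (y : E) (h : ℝ), 0 < h → t + h ≤ T → ε ^ (k + 1) * (T - t) < h →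
      c * cost p ‖y - x‖ h ≤ u x t - u y (t + h) + B * h →
      u x t - u y (t + h) + B * h ≤ L * h ^ β := by
    have base : ∀ (y : E) (h : ℝ), 0 < h → t + h ≤ T → ε * (T - t) < h →
        u x t - u y (t + h) + B * h ≤ L * h ^ β := by
      intro y h hh hhT hlt
      have h1 := abs_le.1 (hub x t ⟨ht, by linarith⟩)
      have h2 := abs_le.1 (hub y (t + h) ⟨by linarith, hhT⟩)
      have h3 : B * h ≤ B * T := by gcongr; linarith
      have h4 : (ε * τ) ^ β ≤ h ^ β := by
        apply Real.rpow_le_rpow (by positivity) _ hβ0.le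
        nlinarith
      have := mul_le_mul_of_nonneg_left h4 hL0.le
      linarith
    intro k
    induction k with
    | zero => intro y h hh hhT hlt _; exact base y h hh hhT (by simpa using hlt)
    | succ k ih =>
      intro y h hh hhT hlt hy
      rcases lt_or_ge (ε * (T - t)) h with h1 | h1
      · exact base y h hh hhT h1
      have h2 : t + h / ε ≤ T := by
        have : h / ε ≤ T - t := by rw [div_le_iff₀ hε]; linarith
        linarith
      obtain ⟨y', h3, h4⟩ := hu.excess_le hp hA hc hB hG1 hG hε hε1 hGε ht hh h2 hy
      have h5 := ih y' (h / ε) (by positivity) h2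
        (by rw [lt_div_iff₀ hε]; rw [pow_succ] at hlt; linarith) h3
      refine h4.trans ?_
      rw [Real.div_rpow hh.le hε.le] at h5
      have hhβ : 0 < h ^ β := by positivity
      have h6 : lam * (L * (h ^ β / ε ^ β)) ≤ √lam * L * h ^ β := by
        have : lam ≤ √lam * ε ^ β := by
          nth_rewrite 1 [← Real.mul_self_sqrt hl0.le]
          gcongr
        have hεβ : 0 < ε ^ β := by positivity
        calc lam * (L * (h ^ β / ε ^ β)) ≤ (√lam * ε ^ β) * (L * (h ^ β / ε ^ β)) := by gcongr
          _ = _ := by field_simp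
      have h7 : 2 * B * (h / ε) ≤ L * (1 - √lam) * h ^ β := by
        have : h ≤ T ^ (1 - β) * h ^ β := by
          calc h = h ^ (1 - β) * h ^ β := by rw [← Real.rpow_add hh]; simp
            _ ≤ _ := by
              gcongr
              · linarith
        calc 2 * B * (h / ε) ≤ 2 * B * (T ^ (1 - β) * h ^ β / ε) := by gcongr
          _ = 2 * B * T ^ (1 - β) / ε * h ^ β := by ring
          _ ≤ _ := by gcongr
      have h8 := mul_le_mul_of_nonneg_left h5 hl0.le
      linarith
  obtain ⟨y, hy⟩ := hu.lower x t (t + h) ht (by linarith) hhT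
  rw [show t + h - t = h by ring] at hy
  have hy' : c * cost p ‖y - x‖ h ≤ u x t - u y (t + h) + B * h := by linarith
  have hTt : 0 < T - t := by linarith
  obtain ⟨k, hk⟩ : ∃ k : ℕ, ε ^ k < h / (T - t) :=
    exists_pow_lt_of_lt_one (by positivity) hε1
  rw [lt_div_iff₀ hTt] at hk
  have hk' : ε ^ (k + 1) * (T - t) < h := by
    refine lt_of_le_of_lt ?_ hk
    gcongr ?_ * _
    exact pow_le_pow_of_le_one hε.le hε1.le (Nat.le_succ k)
  refine ⟨y, hy'.trans (key k y h hh hhT hk' hy'), ?_⟩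
  have := mul_nonneg hc.le (cost_nonneg (p := p) (norm_nonneg (y - x)) hh.le)
  linarith

/-! ### From decay of the action to Hölder continuity. -/

theorem cost_le_iff {p d h R : ℝ} (hp : 0 < p) (hd : 0 ≤ d) (hh : 0 < h) (hR : 0 ≤ R) :
    cost p d h ≤ R ↔ d ≤ R ^ (1 / p) * h ^ ((p - 1) / p) := by
  have e : (R ^ (1 / p) * h ^ ((p - 1) / p)) ^ p = R * h ^ (p - 1) := by
    rw [Real.mul_rpow (by positivity) (by positivity), ← Real.rpow_mul hR, ← Real.rpow_mul hh.le,
      div_mul_cancel₀ _ hp.ne', div_mul_cancel₀ _ hp.ne', Real.rpow_one]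
  rw [← Real.rpow_le_rpow_iff hd (by positivity) hp, e, cost_eq hd hh,
    show 1 - p = -(p - 1) by ring, Real.rpow_neg hh.le, ← div_eq_mul_inv,
    div_le_iff₀ (by positivity)]

/-- Hölder regularity in space and time from the two-sided action bounds. -/
theorem exists_holder_exponent {p A c : ℝ} (hp : 1 < p) (hA : 0 ≤ A) (hc : 0 < c) :
    ∃ θ : ℝ, p < θ ∧ ∀ B M T τ : ℝ, 0 ≤ B → 0 ≤ M → 0 < T → 0 < τ → ∃ K : ℝ,
      ∀ (E : Type) [NormedAddCommGroup E] (u : E → ℝ → ℝ), ActionBounds p A c B T u →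
        (∀ x, |u x T| ≤ M) →
        ∀ (x₀ x₁ : E), ∀ t₀ ∈ Set.Icc 0 (T - τ), ∀ t₁ ∈ Set.Icc 0 (T - τ),
          |u x₀ t₀ - u x₁ t₁| ≤
            K * (‖x₀ - x₁‖ ^ ((θ - p) / (θ - 1)) + |t₀ - t₁| ^ ((θ - p) / θ)) := by
  obtain ⟨β, hβ0, hβ1, hdec⟩ := exists_decay_exponent hp hA hc
  -- Chosen so that `(θ - p) / θ = β`. With `γ = (θ - 1) / θ`, a displacement of order `h ^ γ` in
  -- time `h` costs order `h ^ β`.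
  set θ := p / (1 - β) with hθ
  have hp0 : 0 < p := by linarith
  have hβ' : 0 < 1 - β := by linarith
  have hpθ : p < θ := by rw [hθ, lt_div_iff₀ hβ']; nlinarith
  have hθ0 : 0 < θ := by linarith
  have hθ1 : 0 < θ - 1 := by linarith
  have hβθ : (θ - p) / θ = β := by rw [hθ]; field_simp; ring
  set γ := (θ - 1) / θ with hγ
  have hγ0 : 0 < γ := by positivity
  set α := (θ - p) / (θ - 1) with hα
  have hα0 : 0 < α := div_pos (by linarith) hθ1
  have hαγ : γ * α = β := by rw [← hβθ, hγ, hα]; field_simp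
  have hpγ : γ * p = β + (p - 1) := by rw [← hβθ, hγ]; field_simp; ring
  refine ⟨θ, hpθ, fun B M T τ hB hM hT hτ => ?_⟩
  have hC : 0 ≤ M + B * T := by positivity
  set C := M + B * T with hCdef
  obtain ⟨L, hL, hdec⟩ := hdec B C T τ hB hC hT hτ
  set R := (L / c) ^ (1 / p) with hR
  have hR0 : 0 < R := by positivity
  set S := A * (1 + R) ^ p + 2 * B * T ^ (1 - β) + 2 * C / τ ^ β with hS
  have hS0 : 0 ≤ S := by positivity
  have hlin : ∀ h : ℝ, 0 < h → h ≤ T → h ≤ T ^ (1 - β) * h ^ β := by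
    intro h hh hhT
    calc h = h ^ (1 - β) * h ^ β := by rw [← Real.rpow_add hh]; simp
      _ ≤ _ := by gcongr
  set S' := S * R ^ α + 2 * B * T ^ (1 - β) with hS'
  have hS'0 : 0 ≤ S' := by positivity
  refine ⟨S + S', fun E _ u hu hM' => ?_⟩
  have hub : ∀ x, ∀ t ∈ Set.Icc 0 T, |u x t| ≤ C := fun x t ht =>
    hu.abs_apply_le hp hc.le hB hM' x ht
  have hstep : ∀ (x : E) (t h : ℝ), 0 ≤ t → t + τ ≤ T → 0 < h → t + h ≤ T →
      ∃ y : E, ‖y - x‖ ≤ R * h ^ γ ∧ u y (t + h) ≤ u x t + B * h := by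
    intro x t h ht htτ hh hhT
    obtain ⟨y, hy, hy'⟩ := hdec E u hu hub x t h ht htτ hh hhT
    refine ⟨y, ?_, hy'⟩
    have h1 : cost p ‖y - x‖ h ≤ L / c * h ^ β := by
      rw [div_mul_eq_mul_div, le_div_iff₀ hc]; linarith
    rw [cost_le_iff hp0 (norm_nonneg _) hh (by positivity),
      Real.mul_rpow (by positivity) (by positivity), ← Real.rpow_mul hh.le, mul_assoc,
      ← Real.rpow_add hh] at h1
    convert h1 using 3
    rw [← mul_div_cancel_right₀ γ hp0.ne', hpγ]
    field_simp
  have hspace' : ∀ (x₀ x₁ : E), ∀ t ∈ Set.Icc 0 (T - τ),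
      u x₁ t - u x₀ t ≤ S * ‖x₀ - x₁‖ ^ α := by
    intro x₀ x₁ t ht
    rcases (norm_nonneg (x₀ - x₁)).eq_or_lt with h0 | h0
    · rw [← h0, Real.zero_rpow hα0.ne', mul_zero,
        sub_eq_zero.1 (norm_eq_zero.1 h0.symm), sub_self]
    -- The time in which the displacement scale `h ^ γ` equals the distance: `x₁` then reaches the
    -- endpoint selected for `x₀` at a cost of order `h ^ β`.
    set h := ‖x₀ - x₁‖ ^ (1 / γ) with hh
    have hh0 : 0 < h := by positivity
    have hρ : ‖x₀ - x₁‖ = h ^ γ := by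
      rw [hh, ← Real.rpow_mul h0.le, one_div_mul_cancel hγ0.ne', Real.rpow_one]
    have hρα : ‖x₀ - x₁‖ ^ α = h ^ β := by
      rw [hρ, ← Real.rpow_mul hh0.le, hαγ]
    rw [hρα]
    have hhβ : 0 < h ^ β := by positivity
    rcases le_or_gt h τ with hle | hgt
    · have hhT : t + h ≤ T := by linarith [ht.2]
      obtain ⟨y, hy, hy'⟩ := hstep x₀ t h ht.1 (by linarith [ht.2]) hh0 hhT
      have h1 := hu.upper x₁ y t (t + h) ht.1 (by linarith) hhT
      rw [show t + h - t = h by ring] at h1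
      have h2 : ‖y - x₁‖ ≤ (1 + R) * h ^ γ := by
        have := norm_add_le (y - x₀) (x₀ - x₁)
        rw [sub_add_sub_cancel] at this
        linarith
      have h3 : cost p ‖y - x₁‖ h ≤ (1 + R) ^ p * h ^ β := by
        refine (cost_mono hp0.le (norm_nonneg _) h2 hh0.le).trans_eq ?_
        rw [cost_eq (by positivity) hh0, Real.mul_rpow (by positivity) (by positivity),
          ← Real.rpow_mul hh0.le, hpγ, mul_assoc, ← Real.rpow_add hh0]
        congr 2; ring
      have h4 : A * cost p ‖y - x₁‖ h ≤ A * (1 + R) ^ p * h ^ β := by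
        rw [mul_assoc]; gcongr
      have h5 := mul_le_mul_of_nonneg_left (hlin h hh0 (by linarith [ht.1])) hB
      have h6 : 0 ≤ 2 * C / τ ^ β * h ^ β := by positivity
      rw [hS]
      linarith
    · have h1 := abs_le.1 (hub x₀ t ⟨ht.1, by linarith [ht.2]⟩)
      have h2 := abs_le.1 (hub x₁ t ⟨ht.1, by linarith [ht.2]⟩)
      have h3 : 2 * C ≤ 2 * C / τ ^ β * h ^ β := by
        rw [div_mul_eq_mul_div, le_div_iff₀ (by positivity)]
        gcongr
      have h4 : 0 ≤ (A * (1 + R) ^ p + 2 * B * T ^ (1 - β)) * h ^ β := by positivity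
      rw [hS]
      linarith
  have hspace : ∀ (x₀ x₁ : E), ∀ t ∈ Set.Icc 0 (T - τ),
      |u x₀ t - u x₁ t| ≤ S * ‖x₀ - x₁‖ ^ α := by
    intro x₀ x₁ t ht
    rw [abs_le]
    have h1 := hspace' x₀ x₁ t ht
    have h2 := hspace' x₁ x₀ t ht
    rw [norm_sub_rev] at h2
    constructor <;> linarith
  have htime' : ∀ (x : E), ∀ t₀ ∈ Set.Icc 0 (T - τ), ∀ t₁ ∈ Set.Icc 0 (T - τ), t₀ ≤ t₁ →
      |u x t₀ - u x t₁| ≤ S' * |t₀ - t₁| ^ β := by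
    intro x t₀ ht₀ t₁ ht₁ hle
    rcases hle.eq_or_lt with rfl | hlt
    · simp [Real.zero_rpow hβ0.ne']
    obtain ⟨h, rfl⟩ : ∃ h, t₁ = t₀ + h := ⟨t₁ - t₀, by ring⟩
    have hh0 : 0 < h := by linarith
    have hhT : t₀ + h ≤ T := by linarith [ht₁.2]
    obtain ⟨y, hy, hy'⟩ := hstep x t₀ h ht₀.1 (by linarith [ht₀.2]) hh0 hhT
    have h1 := hu.upper x x t₀ (t₀ + h) ht₀.1 hlt hhT
    rw [sub_self, norm_zero, cost_zero hp0, show t₀ + h - t₀ = h by ring] at h1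
    -- Staying put bounds only `u x t₀ - u x t₁`. The opposite difference passes through `y` and
    -- returns to `x` by the spatial estimate at the later time.
    have h2 := hspace' y x (t₀ + h) ht₁
    have h3 : ‖y - x‖ ^ α ≤ R ^ α * h ^ β := by
      rw [← hαγ, Real.rpow_mul hh0.le, ← Real.mul_rpow (by positivity) (by positivity)]
      gcongr
    have h4 := mul_le_mul_of_nonneg_left h3 hS0
    have h5 := mul_le_mul_of_nonneg_left (hlin h hh0 (by linarith [ht₀.1])) hB
    have h6 : 0 ≤ S * (R ^ α * h ^ β) := by positivity
    have h7 : 0 ≤ B * (T ^ (1 - β) * h ^ β) := by positivity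
    rw [show t₀ - (t₀ + h) = -h by ring, abs_neg, abs_of_pos hh0, hS', abs_le]
    constructor <;> linarith
  have htime : ∀ (x : E), ∀ t₀ ∈ Set.Icc 0 (T - τ), ∀ t₁ ∈ Set.Icc 0 (T - τ),
      |u x t₀ - u x t₁| ≤ S' * |t₀ - t₁| ^ β := by
    intro x t₀ ht₀ t₁ ht₁
    rcases le_total t₀ t₁ with hle | hle
    · exact htime' x t₀ ht₀ t₁ ht₁ hle
    · rw [abs_sub_comm, abs_sub_comm t₀]
      exact htime' x t₁ ht₁ t₀ ht₀ hle
  intro x₀ x₁ t₀ ht₀ t₁ ht₁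
  rw [hβθ]
  have h1 := hspace x₀ x₁ t₀ ht₀
  have h2 := htime x₁ t₀ ht₀ t₁ ht₁
  have h3 := abs_sub_le (u x₀ t₀) (u x₁ t₀) (u x₁ t₁)
  have h4 : 0 ≤ S' * ‖x₀ - x₁‖ ^ α := by positivity
  have h5 : 0 ≤ S * |t₀ - t₁| ^ β := by positivity
  linarith

/-! ### Local test functions and penalised minima. -/

open Filter Topology Metric

/-- Multiplication by a bump function. It is needed because the test functions below are singular at
the base time of a cylinder. -/
theorem exists_contDiff_eventuallyEq {F : Type*} [NormedAddCommGroup F] [NormedSpace ℝ F]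
    [FiniteDimensional ℝ F] {φ : F → ℝ} {U : Set F} {z : F} (hU : IsOpen U)
    (hφ : ContDiffOn ℝ 1 φ U) (hz : z ∈ U) : ∃ ψ : F → ℝ, ContDiff ℝ 1 ψ ∧ ψ =ᶠ[𝓝 z] φ := by
  obtain ⟨r, hr, hrU⟩ := nhds_basis_closedBall.mem_iff.1 (hU.mem_nhds hz)
  let χ : ContDiffBump z := ⟨r / 2, r, by positivity, by linarith⟩
  refine ⟨fun y => χ y * φ y, ?_, ?_⟩
  · rw [contDiff_iff_contDiffAt]
    intro y
    by_cases hy : y ∈ U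
    · exact χ.contDiff.contDiffAt.mul (hφ.contDiffAt (hU.mem_nhds hy))
    · have h1 : y ∉ tsupport χ := fun h => hy (hrU (by rwa [χ.tsupport_eq] at h))
      have h2 : (fun y => χ y * φ y) =ᶠ[𝓝 y] fun _ => 0 := by
        filter_upwards [notMem_tsupport_iff_eventuallyEq.1 h1] with w hw
        simp [hw]
      exact contDiffAt_const.congr_of_eventuallyEq h2
  · filter_upwards [χ.eventuallyEq_one] with y hy
    simp [hy]

theorem hjOperator_congr {N : ℕ} {q : ℝ} {b : Space N → ℝ → ℝ} {f : Space N → ℝ → Space N}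
    {φ ψ : Space N × ℝ → ℝ} {x : Space N} {t φt : ℝ} {ξ : Space N} (h : ψ =ᶠ[𝓝 (x, t)] φ)
    (h1 : HasDerivAt (fun s : ℝ => φ (x, s)) φt t)
    (h2 : HasGradientAt (fun y : Space N => φ (y, t)) ξ x) :
    hjOperator q b f ψ x t = -φt + hamiltonian q b f x t ξ := by
  have e1 : (fun s : ℝ => ψ (x, s)) =ᶠ[𝓝 t] fun s => φ (x, s) :=
    (Continuous.prodMk_right x).continuousAt.eventually h
  have e2 : (fun y : Space N => ψ (y, t)) =ᶠ[𝓝 x] fun y => φ (y, t) :=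
    (Continuous.prodMk_left t).continuousAt.eventually h
  rw [hjOperator, (h1.congr_of_eventuallyEq e1).deriv]
  congr 2
  exact HasGradientAt.gradient (HasFDerivAt.congr_of_eventuallyEq h2 e2)

/-- Test functions of a subsolution only need to be `C¹` near the contact point. -/
theorem IsViscositySubsolution.le_zero {N : ℕ} {q T : ℝ} {b : Space N → ℝ → ℝ}
    {f : Space N → ℝ → Space N} {u : Space N → ℝ → ℝ} (hu : IsViscositySubsolution q T b f u)
    {φ : Space N × ℝ → ℝ} {U : Set (Space N × ℝ)} (hU : IsOpen U) (hφ : ContDiffOn ℝ 1 φ U)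
    {x : Space N} {t : ℝ} (hz : (x, t) ∈ U) (ht : t ∈ Set.Ioo 0 T)
    (hmax : IsLocalMax (fun z : Space N × ℝ => u z.1 z.2 - φ z) (x, t)) {φt : ℝ} {ξ : Space N}
    (h1 : HasDerivAt (fun s : ℝ => φ (x, s)) φt t)
    (h2 : HasGradientAt (fun y : Space N => φ (y, t)) ξ x) :
    -φt + hamiltonian q b f x t ξ ≤ 0 := by
  obtain ⟨ψ, hψ, he⟩ := exists_contDiff_eventuallyEq hU hφ hz
  rw [← hjOperator_congr he h1 h2]
  refine hu ψ hψ x t ht (hmax.congr ?_)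
  filter_upwards [he] with y hy
  rw [hy]

/-- Test functions of a supersolution only need to be `C¹` near the contact point. -/
theorem IsViscositySupersolution.zero_le {N : ℕ} {q T : ℝ} {b : Space N → ℝ → ℝ}
    {f : Space N → ℝ → Space N} {u : Space N → ℝ → ℝ} (hu : IsViscositySupersolution q T b f u)
    {φ : Space N × ℝ → ℝ} {U : Set (Space N × ℝ)} (hU : IsOpen U) (hφ : ContDiffOn ℝ 1 φ U)
    {x : Space N} {t : ℝ} (hz : (x, t) ∈ U) (ht : t ∈ Set.Ioo 0 T)
    (hmin : IsLocalMin (fun z : Space N × ℝ => u z.1 z.2 - φ z) (x, t)) {φt : ℝ} {ξ : Space N}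
    (h1 : HasDerivAt (fun s : ℝ => φ (x, s)) φt t)
    (h2 : HasGradientAt (fun y : Space N => φ (y, t)) ξ x) :
    0 ≤ -φt + hamiltonian q b f x t ξ := by
  obtain ⟨ψ, hψ, he⟩ := exists_contDiff_eventuallyEq hU hφ hz
  rw [← hjOperator_congr he h1 h2]
  refine hu ψ hψ x t ht (hmin.congr ?_)
  filter_upwards [he] with y hy
  rw [hy]

/-- If `v + P` is larger on the lateral and final boundary of a cylinder than `v` at the centre
of its base, then a penalisation of `v + P` blowing up at the base has an interior minimum. -/
theorem exists_isLocalMin_penalized {E : Type*} [NormedAddCommGroup E] [ProperSpace E]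
    {v P : E → ℝ → ℝ} {ρ r₁ r₂ κ C₀ : ℝ} (hρ : 0 < ρ) (h12 : r₁ < r₂)
    (hv : ContinuousOn (fun z : E × ℝ => v z.1 z.2) (closedBall 0 ρ ×ˢ Set.Icc r₁ r₂))
    (hP : ContinuousOn (fun z : E × ℝ => P z.1 z.2) (closedBall 0 ρ ×ˢ Set.Ioc r₁ r₂))
    (hPC : ∀ w, ‖w‖ ≤ ρ → ∀ r ∈ Set.Ioc r₁ r₂, -C₀ ≤ P w r)
    (hP0 : ∀ r ∈ Set.Ioc r₁ r₂, P 0 r ≤ 0) (hκ : 0 < κ)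
    (hlat : ∀ w, ‖w‖ = ρ → ∀ r ∈ Set.Ioc r₁ r₂, v 0 r₁ + κ ≤ v w r + P w r)
    (hend : ∀ w, ‖w‖ ≤ ρ → v 0 r₁ + κ ≤ v w r₂ + P w r₂) :
    ∃ μ : ℝ, 0 < μ ∧ ∃ w r, ‖w‖ < ρ ∧ r ∈ Set.Ioo r₁ r₂ ∧
      IsLocalMin (fun z : E × ℝ => v z.1 z.2 + P z.1 z.2 + μ / (z.2 - r₁)) (w, r) := by
  obtain ⟨r₀, hr₀, hvr₀⟩ : ∃ r₀ ∈ Set.Ioo r₁ r₂, v 0 r₀ < v 0 r₁ + κ / 2 := by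
    have h1 : ContinuousWithinAt (fun r => v 0 r) (Set.Icc r₁ r₂) r₁ := by
      have := hv (0, r₁) ⟨by simp [hρ.le], by simp [h12.le]⟩
      refine ContinuousWithinAt.comp (g := fun z : E × ℝ => v z.1 z.2)
        (f := fun r => ((0 : E), r)) (x := r₁) this (by fun_prop) ?_
      intro r hr
      exact ⟨by simp [hρ.le], hr⟩
    have h2 := h1.mono Set.Ioo_subset_Icc_self
    have h3 : ∀ᶠ r in 𝓝[Set.Ioo r₁ r₂] r₁, v 0 r < v 0 r₁ + κ / 2 :=
      h2.eventually (gt_mem_nhds (by linarith))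
    have : (𝓝[Set.Ioo r₁ r₂] r₁).NeBot := left_nhdsWithin_Ioo_neBot h12
    obtain ⟨r, h4, h5⟩ := (h3.and self_mem_nhdsWithin).exists
    exact ⟨r, h5, h4⟩
  have hcpt : IsCompact (closedBall (0 : E) ρ ×ˢ Set.Icc r₁ r₂) :=
    (isCompact_closedBall 0 ρ).prod isCompact_Icc
  obtain ⟨Bd, hBd⟩ := hcpt.exists_bound_of_continuousOn hv
  -- The penalty is only `κ / 4` at `r₀`, so `(0, r₀)` lies below the boundary level `v 0 r₁ + κ`.
  -- At time `r₁ + η` it outweighs the lower bounds of `v` and `P`, so the minimum is not at the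
  -- base.
  set μ := (r₀ - r₁) * (κ / 4) with hμ
  have hr₀' : 0 < r₀ - r₁ := by linarith [hr₀.1]
  have hμ0 : 0 < μ := by positivity
  set Q := |Bd| + |C₀| + |v 0 r₁| + κ with hQ
  have hQ0 : 0 < Q := by positivity
  set η := min (r₀ - r₁) (μ / Q) with hη
  have hη0 : 0 < η := lt_min hr₀' (by positivity)
  have hηr : r₁ + η ≤ r₀ := by linarith [min_le_left (r₀ - r₁) (μ / Q)]
  have hηQ : Q ≤ μ / η := by
    rw [le_div_iff₀ hη0, mul_comm, ← le_div_iff₀ hQ0]; exact min_le_right _ _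
  have hcpt' : IsCompact (closedBall (0 : E) ρ ×ˢ Set.Icc (r₁ + η) r₂) :=
    (isCompact_closedBall 0 ρ).prod isCompact_Icc
  have hcont : ContinuousOn (fun z : E × ℝ => v z.1 z.2 + P z.1 z.2 + μ / (z.2 - r₁))
      (closedBall 0 ρ ×ˢ Set.Icc (r₁ + η) r₂) := by
    refine ((hv.mono ?_).add (hP.mono ?_)).add (ContinuousOn.div (by fun_prop) (by fun_prop) ?_)
    · exact Set.prod_mono_right (Set.Icc_subset_Icc_left (by linarith))
    · exact Set.prod_mono_right fun r hr => ⟨by linarith [hr.1], hr.2⟩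
    · rintro ⟨w, r⟩ ⟨-, hr⟩
      have := hr.1
      simp only at this ⊢
      linarith
  obtain ⟨⟨w, r⟩, ⟨hw, hr⟩, hmin⟩ := hcpt'.exists_isMinOn
    ⟨(0, r₀), by simp [hρ.le], by simpa using ⟨hηr, hr₀.2.le⟩⟩ hcont
  have hw' : ‖w‖ ≤ ρ := by simpa using hw
  simp only at hr
  have hr1 : 0 < r - r₁ := by linarith [hr.1]
  have hrm : r ∈ Set.Ioc r₁ r₂ := ⟨by linarith, hr.2⟩
  have hval : v w r + P w r + μ / (r - r₁) < v 0 r₁ + κ := by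
    have h1 := isMinOn_iff.1 hmin ((0 : E), r₀) ⟨by simp [hρ.le], hηr, hr₀.2.le⟩
    simp only at h1
    have h2 : μ / (r₀ - r₁) = κ / 4 := by rw [hμ]; field_simp
    have h3 := hP0 r₀ ⟨hr₀.1, hr₀.2.le⟩
    linarith
  have hμr : 0 < μ / (r - r₁) := by positivity
  have hwρ : ‖w‖ < ρ := by
    refine hw'.lt_of_ne fun h => ?_
    have := hlat w h r hrm
    linarith
  have hrr₂ : r < r₂ := by
    refine hr.2.lt_of_ne fun h => ?_
    have := hend w hw'
    rw [h] at hval hμr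
    linarith
  have hrη : r₁ + η < r := by
    refine hr.1.lt_of_ne fun h => ?_
    have h1 := hBd (w, r) ⟨hw, by linarith, hr.2⟩
    rw [Real.norm_eq_abs] at h1
    have h2 := hPC w hw' r hrm
    rw [← h, show r₁ + η - r₁ = η by ring, h] at hval
    have h3 := (abs_le.1 h1).1
    have h4 := le_abs_self Bd
    have h5 := le_abs_self C₀
    have h6 := le_abs_self (v 0 r₁)
    simp only at h3
    linarith
  refine ⟨μ, hμ0, w, r, hwρ, ⟨by linarith, hrr₂⟩, ?_⟩
  refine hmin.isLocalMin (prod_mem_nhds ?_ (Icc_mem_nhds hrη hrr₂))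
  exact mem_of_superset (isOpen_ball.mem_nhds (by simpa using hwρ)) ball_subset_closedBall

theorem hasGradientAt_of_hasFDerivAt {N : ℕ} {φ : Space N → ℝ} {x ξ : Space N}
    {L : Space N →L[ℝ] ℝ} (h : HasFDerivAt φ L x) (hL : ∀ e, L e = inner ℝ ξ e) :
    HasGradientAt φ ξ x := by
  have e : InnerProductSpace.toDual ℝ (Space N) ξ = L := by
    ext e
    simp [hL]
  rw [hasGradientAt_iff_hasFDerivAt, e]
  exact h

/-! ### Upper action bound: subsolutions along lines. -/

/-- Monotonicity of a subsolution along straight lines. -/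
theorem IsViscositySubsolution.le_add_of_line {N : ℕ} {q T : ℝ} {b : Space N → ℝ → ℝ}
    {f : Space N → ℝ → Space N} {u : Space N → ℝ → ℝ} (hu : IsViscositySubsolution q T b f u)
    (hc : ContinuousOn (fun z : Space N × ℝ => u z.1 z.2) (Set.univ ×ˢ Set.Icc 0 T))
    {a : Space N} {K : ℝ} (hK0 : 0 ≤ K)
    (hK : ∀ x, ∀ t ∈ Set.Ioo 0 T, ∀ ξ, -K ≤ hamiltonian q b f x t ξ + inner ℝ a ξ)
    (x : Space N) {r₁ r₂ : ℝ} (h0 : 0 ≤ r₁) (h12 : r₁ < r₂) (h2 : r₂ ≤ T) :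
    u x r₁ ≤ u (x + (r₂ - r₁) • a) r₂ + K * (r₂ - r₁) := by
  by_contra! hlt
  set D := u x r₁ - (u (x + (r₂ - r₁) • a) r₂ + K * (r₂ - r₁)) with hD
  have hD0 : 0 < D := by linarith
  set X : ℝ → Space N := fun r => x + (r - r₁) • a with hX
  have hXc : Continuous X := by fun_prop
  have hvc : ContinuousOn (fun z : Space N × ℝ => -u (X z.2 + z.1) z.2)
      (Set.univ ×ˢ Set.Icc r₁ r₂) := by
    refine ContinuousOn.neg (hc.comp (f := fun z : Space N × ℝ => (X z.2 + z.1, z.2))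
      (by fun_prop) ?_)
    rintro ⟨w, r⟩ ⟨-, hr⟩
    exact ⟨trivial, h0.trans hr.1, hr.2.trans h2⟩
  obtain ⟨ρ, hρ, hρend⟩ : ∃ ρ > 0, ∀ w : Space N, ‖w‖ ≤ ρ →
      -u (X r₂) r₂ - D / 4 < -u (X r₂ + w) r₂ := by
    have h1 : ContinuousAt (fun w : Space N => -u (X r₂ + w) r₂) 0 := by
      have h3 : ContinuousOn (fun w : Space N => -u (X r₂ + w) r₂) Set.univ :=
        hvc.comp (f := fun w : Space N => (w, r₂)) (by fun_prop)
          fun w _ => ⟨trivial, h12.le, le_rfl⟩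
      exact h3.continuousAt univ_mem
    have h3 : ∀ᶠ w in 𝓝 (0 : Space N), -u (X r₂) r₂ - D / 4 < -u (X r₂ + w) r₂ := by
      refine h1.eventually (lt_mem_nhds ?_)
      simp only [add_zero]; linarith
    obtain ⟨ρ, hρ, h4⟩ := nhds_basis_closedBall.eventually_iff.1 h3
    exact ⟨ρ, hρ, fun w hw => h4 (by simpa using hw)⟩
  obtain ⟨Bd, hBd⟩ := ((isCompact_closedBall (0 : Space N) ρ).prod
    (isCompact_Icc (a := r₁) (b := r₂))).exists_bound_of_continuousOn
      (hvc.mono (Set.prod_mono_left (Set.subset_univ _)))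
  -- Large enough for the quadratic term to dominate on the lateral boundary.
  set n := (|Bd| + |u x r₁| + K * (r₂ - r₁) + D) / ρ ^ 2 with hn
  have hr21 : 0 < r₂ - r₁ := by linarith
  have hn0 : 0 ≤ n := by positivity
  have hX1 : X r₁ = x := by simp [hX]
  have hKr : ∀ r ∈ Set.Ioc r₁ r₂, K * (r - r₁) ≤ K * (r₂ - r₁) := fun r hr => by
    gcongr; exact hr.2
  obtain ⟨μ, hμ, w, r, hw, hr, hmin⟩ := exists_isLocalMin_penalized (E := Space N)
    (v := fun w r => -u (X r + w) r) (P := fun w r => n * ‖w‖ ^ 2 - K * (r - r₁))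
    (κ := D / 2) (C₀ := K * (r₂ - r₁)) hρ h12
    (hvc.mono (Set.prod_mono_left (Set.subset_univ _))) (by fun_prop)
    (by
      intro w _ r hr
      have := hKr r hr
      have : 0 ≤ n * ‖w‖ ^ 2 := by positivity
      linarith)
    (by
      intro r hr
      have : 0 ≤ K * (r - r₁) := mul_nonneg hK0 (by linarith [hr.1])
      simp; linarith)
    (by positivity)
    (by
      intro w hw r hr
      have h1 := hBd (w, r) ⟨by simp [hw], hr.1.le, hr.2⟩
      rw [Real.norm_eq_abs] at h1
      have h3 := (abs_le.1 h1).1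
      have h4 : n * ‖w‖ ^ 2 = |Bd| + |u x r₁| + K * (r₂ - r₁) + D := by
        rw [hw, hn]; field_simp
      have h5 := le_abs_self Bd
      have h6 := neg_abs_le (u x r₁)
      have h7 := hKr r hr
      simp only [add_zero, hX1] at h3 ⊢
      linarith)
    (by
      intro w hw
      have h1 := hρend w hw
      have h3 : 0 ≤ n * ‖w‖ ^ 2 := by positivity
      have h4 : X r₂ = x + (r₂ - r₁) • a := rfl
      rw [← h4] at hD
      simp only [add_zero, hX1]
      linarith)
  set z := X r + w with hz
  have hzw : z - X r = w := by rw [hz]; abel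
  have hr0 : 0 < r - r₁ := by linarith [hr.1]
  set φ : Space N × ℝ → ℝ := fun y =>
    n * ‖y.1 - (x + (y.2 - r₁) • a)‖ ^ 2 - K * (y.2 - r₁) + μ / (y.2 - r₁) with hφ
  have hφU : ContDiffOn ℝ 1 φ {y | r₁ < y.2} := by
    refine ContDiffOn.add (ContDiff.contDiffOn ?_) (ContDiffOn.div contDiffOn_const ?_ ?_)
    · have : ContDiff ℝ 1 fun y : Space N × ℝ => y.1 - (x + (y.2 - r₁) • a) := by fun_prop
      have := this.norm_sq ℝ
      fun_prop
    · exact ContDiff.contDiffOn (by fun_prop)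
    · intro y hy
      have : r₁ < y.2 := hy
      linarith
  have hmax : IsLocalMax (fun y : Space N × ℝ => u y.1 y.2 - φ y) (z, r) := by
    have h1 : ContinuousAt (fun y : Space N × ℝ => (y.1 - X y.2, y.2)) (z, r) := by fun_prop
    rw [← hzw] at hmin
    have h3 := h1.eventually hmin
    filter_upwards [h3] with y hy
    simp only [add_sub_cancel] at hy
    simp only [hφ]
    simp only [hX] at hy
    linarith
  have hder : HasDerivAt (fun s : ℝ => φ (z, s))
      (-(2 * n * inner ℝ w a) - K - μ / (r - r₁) ^ 2) r := by
    have h1 : HasDerivAt (fun s : ℝ => z - (x + (s - r₁) • a)) (-a) r := by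
      have := ((((hasDerivAt_id r).sub_const r₁).smul_const a).const_add x).const_sub z
      simpa using this
    have h3 := (h1.norm_sq).const_mul n
    have h4 := ((hasDerivAt_id r).sub_const r₁).const_mul K
    have h5 := (((hasDerivAt_id r).sub_const r₁).inv hr0.ne').const_mul μ
    have h6 := (h3.sub h4).add h5
    refine h6.congr_deriv ?_
    have : z - (x + (r - r₁) • a) = w := hzw
    rw [this]
    simp only [inner_neg_right, id]
    ring
  have hgrad : HasGradientAt (fun y : Space N => φ (y, r)) ((2 * n) • w) z := by
    have h1 : HasFDerivAt (fun y : Space N => y - (x + (r - r₁) • a))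
        (ContinuousLinearMap.id ℝ (Space N)) z := (hasFDerivAt_id z).sub_const _
    have h3 := (((h1.norm_sq).const_mul n).sub_const (K * (r - r₁))).add_const (μ / (r - r₁))
    refine hasGradientAt_of_hasFDerivAt h3 fun e => ?_
    have : z - (x + (r - r₁) • a) = w := hzw
    rw [this]
    simp [inner_smul_left]
    ring
  have hU : IsOpen {y : Space N × ℝ | r₁ < y.2} := isOpen_lt continuous_const continuous_snd
  have hrT : r ∈ Set.Ioo 0 T := ⟨by linarith, by linarith [hr.2]⟩
  have hfin := hu.le_zero hU hφU (show (z, r) ∈ {y : Space N × ℝ | r₁ < y.2} from hr.1) hrT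
    hmax hder hgrad
  -- The moving centre contributes `inner ℝ a ξ` to `-φt`, with `ξ` the gradient, which completes
  -- the expression in `hK`; the penalty then makes the inequality strict.
  have h1 := hK z r hrT ((2 * n) • w)
  have h3 : 0 < μ / (r - r₁) ^ 2 := by positivity
  rw [inner_smul_right, real_inner_comm] at h1
  linarith

/-! ### Lower action bound: barriers and chains of cylinders. -/

theorem exists_lt_rpow {p : ℝ} (hp : 1 < p) (Q : ℝ) {R : ℝ} (hR : 0 < R) :
    ∃ ε : ℝ, 0 < ε ∧ ε < R ∧ Q < ε ^ (1 - p) := by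
  have h1 := (tendsto_rpow_neg_nhdsGT_zero (y := 1 - p) (by linarith)).eventually_gt_atTop Q
  obtain ⟨ε, h2, h3⟩ := (h1.and (Ioo_mem_nhdsGT hR)).exists
  exact ⟨ε, h3.1, h3.2, h2⟩

/-- A supersolution admits a competitor on the lateral or final boundary of a unit cylinder. -/
theorem IsViscositySupersolution.exists_exit {N : ℕ} {q T : ℝ} {b : Space N → ℝ → ℝ}
    {f : Space N → ℝ → Space N} {u : Space N → ℝ → ℝ} (hu : IsViscositySupersolution q T b f u)
    (hcont : ContinuousOn (fun z : Space N × ℝ => u z.1 z.2) (Set.univ ×ˢ Set.Icc 0 T))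
    {p M c : ℝ} (hp : 1 < p) (hpq : (p - 1) * q = p) (hM : 0 < M) (hc : 0 < c)
    (hcM : 2 * M * (c * p) ^ q ≤ c * (p - 1))
    (hH : ∀ x, ∀ t ∈ Set.Ioo 0 T, ∀ ξ, hamiltonian q b f x t ξ ≤ 2 * M * ‖ξ‖ ^ q + M)
    (x : Space N) {t s : ℝ} (h0 : 0 ≤ t) (hts : t < s) (hs : s ≤ T) :
    ∃ y r, t < r ∧ r ≤ s ∧ ‖y - x‖ ≤ 1 ∧ (r = s ∨ ‖y - x‖ = 1) ∧
      u y r + c * cost p ‖y - x‖ (r - t) - (M + 1) * (r - t) ≤ u x t := by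
  by_contra! hno
  have hp0 : 0 < p := by linarith
  have hvc : ContinuousOn (fun z : Space N × ℝ => u (x + z.1) z.2)
      (Set.univ ×ˢ Set.Icc t s) := by
    refine hcont.comp (f := fun z : Space N × ℝ => (x + z.1, z.2)) (by fun_prop) ?_
    rintro ⟨w, r⟩ ⟨-, hr⟩
    exact ⟨trivial, h0.trans hr.1, hr.2.trans hs⟩
  obtain ⟨Bd, hBd⟩ := ((isCompact_closedBall (0 : Space N) 1).prod
    (isCompact_Icc (a := t) (b := s))).exists_bound_of_continuousOn
      (hvc.mono (Set.prod_mono_left (Set.subset_univ _)))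
  have hst : 0 < s - t := by linarith
  -- For `r - t ≥ κ` the slack between `M + 1` and `M` gives the gap `κ`; for shorter times the
  -- lateral cost `c * (r - t) ^ (1 - p)` is large enough by itself.
  obtain ⟨κ, hκ0, hκ, hκQ⟩ := exists_lt_rpow hp
    ((|Bd| + |u x t| + M * (s - t) + (s - t)) / c) hst
  rw [div_lt_iff₀ hc] at hκQ
  have hcostc : ContinuousOn (fun z : Space N × ℝ => c * (‖z.1‖ ^ p * (z.2 - t) ^ (1 - p)) -
      M * (z.2 - t)) (closedBall 0 1 ×ˢ Set.Ioc t s) := by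
    refine ContinuousOn.sub (continuousOn_const.mul (ContinuousOn.mul ?_ ?_)) (by fun_prop)
    · exact (continuous_fst.norm.rpow_const fun _ => Or.inr hp0.le).continuousOn
    · refine ContinuousOn.rpow_const (by fun_prop) ?_
      rintro ⟨w, r⟩ ⟨-, hr⟩
      have : t < r := hr.1
      exact Or.inl (by simp only; linarith)
  obtain ⟨μ, hμ, w, r, hw, hr, hmin⟩ := exists_isLocalMin_penalized (E := Space N)
    (v := fun w r => u (x + w) r)
    (P := fun w r => c * (‖w‖ ^ p * (r - t) ^ (1 - p)) - M * (r - t))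
    (κ := κ) (C₀ := M * (s - t)) one_pos hts
    (hvc.mono (Set.prod_mono_left (Set.subset_univ _))) hcostc
    (by
      intro w _ r hr
      have h1 : 0 < r - t := by linarith [hr.1]
      have h2 : 0 ≤ c * (‖w‖ ^ p * (r - t) ^ (1 - p)) := by positivity
      have h3 : M * (r - t) ≤ M * (s - t) := by gcongr; exact hr.2
      linarith)
    (by
      intro r hr
      have : 0 ≤ M * (r - t) := mul_nonneg hM.le (by linarith [hr.1])
      simp [Real.zero_rpow hp0.ne']; linarith)
    hκ0
    (by
      intro w hw r hr
      have hr0 : 0 < r - t := by linarith [hr.1]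
      simp only [add_zero]
      rcases le_or_gt κ (r - t) with h | h
      · have h1 := hno (x + w) r hr.1 hr.2 (by simp [hw]) (by simp [hw])
        rw [cost_eq (norm_nonneg _) hr0, add_sub_cancel_left] at h1
        linarith
      · have h1 := hBd (w, r) ⟨by simp [hw], hr.1.le, hr.2⟩
        rw [Real.norm_eq_abs] at h1
        have h3 := (abs_le.1 h1).1
        have h5 := le_abs_self Bd
        have h6 := le_abs_self (u x t)
        have h7 : κ ^ (1 - p) ≤ (r - t) ^ (1 - p) :=
          Real.rpow_le_rpow_of_nonpos hr0 h.le (by linarith)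
        have h8 := mul_le_mul_of_nonneg_right h7 hc.le
        have h9 : M * (r - t) ≤ M * (s - t) := by gcongr; exact hr.2
        rw [hw, Real.one_rpow, one_mul]
        simp only at h3
        linarith)
    (by
      intro w hw
      have h1 := hno (x + w) s hts le_rfl (by simpa using hw) (by simp)
      rw [cost_eq (norm_nonneg _) hst, add_sub_cancel_left] at h1
      simp only [add_zero]
      linarith)
  set z := x + w with hz
  have hzw : z - x = w := by rw [hz]; abel
  have hr0 : 0 < r - t := by linarith [hr.1]
  set φ : Space N × ℝ → ℝ := fun y =>
    M * (y.2 - t) - c * (‖y.1 - x‖ ^ p * (y.2 - t) ^ (1 - p)) - μ / (y.2 - t) with hφ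
  have hφU : ContDiffOn ℝ 1 φ {y | t < y.2} := by
    have hne : ∀ y ∈ {y : Space N × ℝ | t < y.2}, y.2 - t ≠ 0 := by
      intro y hy
      have : t < y.2 := hy
      linarith
    refine ContDiffOn.sub (ContDiffOn.sub (ContDiff.contDiffOn (by fun_prop))
      (contDiffOn_const.mul (ContDiffOn.mul ?_ ?_))) (ContDiffOn.div contDiffOn_const ?_ hne)
    · exact ((contDiff_norm_rpow hp).comp
        (contDiff_fst.sub contDiff_const)).contDiffOn
    · exact ContDiffOn.rpow_const_of_ne (ContDiff.contDiffOn (by fun_prop)) hne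
    · exact ContDiff.contDiffOn (by fun_prop)
  have hmin' : IsLocalMin (fun y : Space N × ℝ => u y.1 y.2 - φ y) (z, r) := by
    have h1 : ContinuousAt (fun y : Space N × ℝ => (y.1 - x, y.2)) (z, r) := by fun_prop
    rw [← hzw] at hmin
    have h3 := h1.eventually hmin
    filter_upwards [h3] with y hy
    simp only [add_sub_cancel] at hy
    simp only [hφ]
    linarith
  have hder : HasDerivAt (fun s : ℝ => φ (z, s))
      (M + c * (p - 1) * (‖w‖ ^ p * (r - t) ^ (-p)) + μ / (r - t) ^ 2) r := by
    have h1 := (hasDerivAt_id r).sub_const t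
    have h2 := h1.const_mul M
    have h3 := ((h1.rpow_const (p := 1 - p) (Or.inl hr0.ne')).const_mul (‖w‖ ^ p)).const_mul c
    have h4 := (h1.inv hr0.ne').const_mul μ
    have h5 := (h2.sub h3).sub h4
    rw [← hzw] at h5
    refine h5.congr_deriv ?_
    rw [hzw, show 1 - p - 1 = -p by ring]
    simp only [id]
    ring
  have hgrad : HasGradientAt (fun y : Space N => φ (y, r))
      (-(c * (r - t) ^ (1 - p) * (p * ‖w‖ ^ (p - 2))) • w) z := by
    have h1 : HasFDerivAt (fun y : Space N => y - x)
        (ContinuousLinearMap.id ℝ (Space N)) z := (hasFDerivAt_id z).sub_const _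
    have h2 := (hasFDerivAt_norm_rpow (z - x) hp).comp z h1
    have h3 := (((h2.mul_const ((r - t) ^ (1 - p))).const_mul c).const_sub
      (M * (r - t))).sub_const (μ / (r - t))
    refine hasGradientAt_of_hasFDerivAt h3 fun e => ?_
    rw [hzw]
    simp [inner_smul_left]
    ring
  have hU : IsOpen {y : Space N × ℝ | t < y.2} := isOpen_lt continuous_const continuous_snd
  have hrT : r ∈ Set.Ioo 0 T := ⟨by linarith, by linarith [hr.2]⟩
  have hfin := hu.zero_le hU hφU (show (z, r) ∈ {y : Space N × ℝ | t < y.2} from hr.1) hrT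
    hmin' hder hgrad
  have h1 := hH z r hrT (-(c * (r - t) ^ (1 - p) * (p * ‖w‖ ^ (p - 2))) • w)
  -- As `(p - 1) * q = p`, the Hamiltonian and the time derivative carry the same factor `‖w‖ ^ p *
  -- (r - t) ^ (-p)`. By `hcM` the latter wins, and the penalty makes the barrier a strict
  -- subsolution.
  have hnorm : ‖-(c * (r - t) ^ (1 - p) * (p * ‖w‖ ^ (p - 2))) • w‖ ^ q =
      (c * p) ^ q * (‖w‖ ^ p * (r - t) ^ (-p)) := by
    have e1 : ‖-(c * (r - t) ^ (1 - p) * (p * ‖w‖ ^ (p - 2))) • w‖ =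
        c * p * (‖w‖ ^ (p - 1) * (r - t) ^ (-(p - 1))) := by
      rw [neg_smul, norm_neg, norm_smul, Real.norm_eq_abs, abs_of_nonneg (by positivity),
        show 1 - p = -(p - 1) by ring]
      rcases (norm_nonneg w).eq_or_lt with h | h
      · rw [← h, Real.zero_rpow (show p - 1 ≠ 0 by linarith)]; ring
      · have : ‖w‖ ^ (p - 1) = ‖w‖ ^ (p - 2) * ‖w‖ := by
          rw [← Real.rpow_add_one h.ne']; congr 1; ring
        rw [this]; ring
    rw [e1, Real.mul_rpow (mul_pos hc hp0).le (by positivity),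
      Real.mul_rpow (x := ‖w‖ ^ (p - 1)) (by positivity) (by positivity), ← Real.rpow_mul (norm_nonneg _),
      ← Real.rpow_mul hr0.le, neg_mul, hpq]
  rw [hnorm] at h1
  have h3 : 0 < μ / (r - t) ^ 2 := by positivity
  have h4 : 0 ≤ ‖w‖ ^ p * (r - t) ^ (-p) := by positivity
  have h5 := mul_le_mul_of_nonneg_right hcM h4
  linarith

/-- `z'` is reached from `z` within distance `d` with a decrease of `u` paying for the action. -/
structure Reaches {E : Type*} [NormedAddCommGroup E] (p c B : ℝ) (u : E → ℝ → ℝ) (d : ℝ)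
    (z z' : E × ℝ) : Prop where
  nonneg : 0 ≤ d
  norm_le : ‖z'.1 - z.1‖ ≤ d
  lt : z.2 < z'.2
  le : u z'.1 z'.2 + c * cost p d (z'.2 - z.2) - B * (z'.2 - z.2) ≤ u z.1 z.2

/-- The cost is charged on the length `d` and not on the net displacement, so successive steps stay
expensive even if the path turns back. -/
theorem Reaches.trans {E : Type*} [NormedAddCommGroup E] {p c B : ℝ} {u : E → ℝ → ℝ} {d e : ℝ}
    {z z' z'' : E × ℝ} (hp : 1 ≤ p) (hc : 0 ≤ c) (h : Reaches p c B u d z z')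
    (h' : Reaches p c B u e z' z'') : Reaches p c B u (d + e) z z'' where
  nonneg := add_nonneg h.nonneg h'.nonneg
  norm_le := by
    have := norm_add_le (z'.1 - z.1) (z''.1 - z'.1)
    rw [show z'.1 - z.1 + (z''.1 - z'.1) = z''.1 - z.1 by abel] at this
    linarith [h.norm_le, h'.norm_le]
  lt := h.lt.trans h'.lt
  le := by
    have h1 := cost_add_le hp h.nonneg h'.nonneg (sub_pos.2 h.lt) (sub_pos.2 h'.lt)
    rw [show z'.2 - z.2 + (z''.2 - z'.2) = z''.2 - z.2 by ring] at h1
    have h2 := mul_le_mul_of_nonneg_left h1 hc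
    linarith [h.le, h'.le]

/-- The upper action bound prevents chains of unit displacements from accumulating in time. -/
theorem not_exists_unit_chain {E : Type*} [NormedAddCommGroup E] {p A c B T : ℝ}
    {u : E → ℝ → ℝ} (hp : 1 < p) (hA : 0 ≤ A) (hc : 0 < c) (hB : 0 ≤ B) (hT : 0 ≤ T)
    (hup : ∀ x y : E, ∀ t s : ℝ, 0 ≤ t → t < s → s ≤ T →
      u x t ≤ u y s + A * cost p ‖y - x‖ (s - t) + B * (s - t))
    (X : ℕ → E × ℝ) (hX0 : 0 ≤ (X 0).2) (hXT : ∀ n, (X n).2 ≤ T)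
    (hstep : ∀ n, Reaches p c B u 1 (X n) (X (n + 1))) : False := by
  have hmono : StrictMono fun n => (X n).2 := strictMono_nat_of_lt_succ fun n => (hstep n).lt
  have hchain : ∀ J k : ℕ, Reaches p c B u (k + 1 : ℝ) (X J) (X (J + (k + 1))) := by
    intro J k
    induction k with
    | zero => simpa using hstep J
    | succ k ih =>
      have := ih.trans hp.le hc.le (hstep (J + (k + 1)))
      push_cast
      exact this
  have hbnd : ∀ n, (X n).2 ∈ Set.Icc 0 T := fun n =>
    ⟨hX0.trans (hmono.monotone (Nat.zero_le n)), hXT n⟩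
  set δ := (X 1).2 - (X 0).2 with hδ
  have hδ0 : 0 < δ := sub_pos.2 (hstep 0).lt
  -- The last `m` unit steps take time less than `ε` and cost at least `c * m ^ p * ε ^ (1 - p)`.
  -- The whole chain has length `2 * m` and lasts at least `δ`, so the upper bound allows only `A *
  -- (2 * m) ^ p * δ ^ (1 - p)` plus drift. The factor `m ^ p` cancels, so `ε` can be fixed before
  -- `J`.
  set Q := A * 2 ^ p * δ ^ (1 - p) + 3 * (B * T) with hQ
  obtain ⟨ε, hε0, -, hεQ⟩ := exists_lt_rpow hp (Q / c) one_pos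
  rw [div_lt_iff₀ hc] at hεQ
  have hlim := tendsto_atTop_ciSup hmono.monotone ⟨T, by rintro _ ⟨n, rfl⟩; exact hXT n⟩
  set S := ⨆ n, (X n).2 with hS
  have hle : ∀ n, (X n).2 ≤ S := fun n => hmono.monotone.ge_of_tendsto hlim n
  obtain ⟨J, hJ⟩ : ∃ J, S - ε < (X (J + 1)).2 := by
    have h1 := (tendsto_add_atTop_iff_nat 1).2 hlim
    exact (h1.eventually (lt_mem_nhds (show S - ε < S by linarith))).exists
  set m : ℝ := (J : ℝ) + 1 with hm
  have hm1 : 1 ≤ m := by rw [hm]; have : (0 : ℝ) ≤ J := J.cast_nonneg; linarith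
  have c1 := hchain (J + 1) J
  have c2 : Reaches p c B u m (X 0) (X (J + 1)) := by simpa using hchain 0 J
  have c3 := c2.trans hp.le hc.le c1
  set Z := X (J + 1 + (J + 1)) with hZ
  have hcost1 : cost p m ε ≤ cost p m (Z.2 - (X (J + 1)).2) :=
    cost_antitone hp.le (by linarith) (sub_pos.2 c1.lt) (by linarith [hle (J + 1 + (J + 1))])
  have hδZ : δ ≤ Z.2 - (X 0).2 := by
    have : (X 1).2 ≤ Z.2 := hmono.monotone (show 1 ≤ J + 1 + (J + 1) by omega)
    linarith
  have h1 := hup (X 0).1 Z.1 (X 0).2 Z.2 hX0 c3.lt (hXT _)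
  have h2 : cost p ‖Z.1 - (X 0).1‖ (Z.2 - (X 0).2) ≤ cost p (m + m) δ :=
    (cost_mono (by linarith) (norm_nonneg _) c3.norm_le (by linarith)).trans
      (cost_antitone hp.le (by linarith) hδ0 hδZ)
  have h3 := mul_le_mul_of_nonneg_left h2 hA
  have h4 := mul_le_mul_of_nonneg_left hcost1 hc.le
  have h5 := mul_nonneg hc.le (cost_nonneg (p := p) c2.nonneg (sub_pos.2 c2.lt).le)
  have h6 := c1.le
  have h7 := c2.le
  have hBT : ∀ i j, B * ((X i).2 - (X j).2) ≤ B * T := fun i j => by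
    gcongr; linarith [(hbnd i).2, (hbnd j).1]
  have h8 := hBT (J + 1 + (J + 1)) 0
  have h9 := hBT (J + 1 + (J + 1)) (J + 1)
  have h10 := hBT (J + 1) 0
  have h11 : c * cost p m ε ≤ A * cost p (m + m) δ + 3 * (B * T) := by linarith
  have hmp : 1 ≤ m ^ p := Real.one_le_rpow hm1 (by linarith)
  rw [cost_eq (by linarith) hε0, cost_eq (by linarith) hδ0, ← two_mul,
    Real.mul_rpow two_pos.le (by linarith)] at h11
  have h12 : 3 * (B * T) ≤ m ^ p * (3 * (B * T)) := le_mul_of_one_le_left (by positivity) hmp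
  have h13 : m ^ p * Q < m ^ p * (ε ^ (1 - p) * c) := by gcongr
  rw [hQ] at h13
  linarith

/-- The lower action bound for supersolutions that satisfy the upper action bound. -/
theorem IsViscositySupersolution.exists_reaches {N : ℕ} {q T : ℝ} {b : Space N → ℝ → ℝ}
    {f : Space N → ℝ → Space N} {u : Space N → ℝ → ℝ} (hu : IsViscositySupersolution q T b f u)
    (hcont : ContinuousOn (fun z : Space N × ℝ => u z.1 z.2) (Set.univ ×ˢ Set.Icc 0 T))
    {p M c A B : ℝ} (hp : 1 < p) (hpq : (p - 1) * q = p) (hM : 0 < M) (hc : 0 < c)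
    (hcM : 2 * M * (c * p) ^ q ≤ c * (p - 1))
    (hH : ∀ x, ∀ t ∈ Set.Ioo 0 T, ∀ ξ, hamiltonian q b f x t ξ ≤ 2 * M * ‖ξ‖ ^ q + M)
    (hA : 0 ≤ A) (hB : M + 1 ≤ B)
    (hup : ∀ x y : Space N, ∀ t s : ℝ, 0 ≤ t → t < s → s ≤ T →
      u x t ≤ u y s + A * cost p ‖y - x‖ (s - t) + B * (s - t))
    (x : Space N) {t s : ℝ} (h0 : 0 ≤ t) (hts : t < s) (hs : s ≤ T) :
    ∃ y, u y s + c * cost p ‖y - x‖ (s - t) - B * (s - t) ≤ u x t := by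
  by_contra! hno
  -- Points reached before time `s`. If the claim fails, no exit from them occurs at time `s`; each
  -- is through the lateral wall, at distance one, and the exits form an infinite chain.
  let G : Type := {z : Space N × ℝ // z.2 < s ∧ (z = (x, t) ∨ ∃ d, Reaches p c B u d (x, t) z)}
  have hG0 : ∀ z : G, 0 ≤ z.1.2 := by
    rintro ⟨z, -, rfl | ⟨d, hd⟩⟩
    · exact h0
    · exact h0.trans hd.lt.le
  have hnext : ∀ z : G, ∃ z' : G, Reaches p c B u 1 z.1 z'.1 := by
    intro z
    obtain ⟨y, r, hr, hrs, hy1, hor, hy⟩ :=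
      hu.exists_exit hcont hp hpq hM hc hcM hH z.1.1 (hG0 z) z.2.1 hs
    have hreach : Reaches p c B u ‖y - z.1.1‖ z.1 (y, r) := by
      refine ⟨norm_nonneg _, le_rfl, hr, ?_⟩
      have := mul_le_mul_of_nonneg_right hB (sub_pos.2 hr).le
      simp only
      linarith
    have hfrom : ∃ d, Reaches p c B u d (x, t) (y, r) := by
      rcases z.2.2 with h | ⟨d, hd⟩
      · rw [h] at hreach
        exact ⟨_, hreach⟩
      · exact ⟨_, hd.trans hp.le hc.le hreach⟩
    have hrs' : r < s := by
      refine hrs.lt_of_ne ?_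
      rintro rfl
      obtain ⟨d, hd⟩ := hfrom
      have h1 := hno y
      have h2 := hd.le
      have h3 := mul_le_mul_of_nonneg_left
        (cost_mono (p := p) (by linarith) (norm_nonneg _) hd.norm_le (sub_pos.2 hts).le) hc.le
      simp only at h2 h3
      linarith
    rw [hor.resolve_left hrs'.ne] at hreach
    exact ⟨⟨(y, r), hrs', Or.inr hfrom⟩, hreach⟩
  choose next hnext using hnext
  let X : ℕ → G := fun n => Nat.rec ⟨(x, t), hts, Or.inl rfl⟩ (fun _ z => next z) n
  exact not_exists_unit_chain hp hA hc (by linarith) (by linarith) hup (fun n => (X n).1)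
    (hG0 _) (fun n => (X n).2.1.le.trans hs) (fun n => hnext (X n))

/-! ### Young's inequality and conclusion. -/

/-- Either the power term dominates, or `s ≤ (L / δ) ^ (p - 1)`, which bounds `L * s`. The constant
is not sharp. -/
theorem young_le {p q δ L s : ℝ} (hpq : (p - 1) * q = p) (hp : 1 < p) (hδ : 0 < δ) (hL : 0 ≤ L)
    (hs : 0 ≤ s) : -(δ ^ (1 - p) * L ^ p) ≤ δ * s ^ q - L * s := by
  rcases hs.eq_or_lt with rfl | hs0
  · have : 0 ≤ δ ^ (1 - p) * L ^ p := by positivity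
    have : 0 ≤ δ * (0 : ℝ) ^ q := by positivity
    linarith
  have hp1 : 0 < p - 1 := by linarith
  have hpow : s ^ q = (s ^ (q - 1)) * s := by rw [← Real.rpow_add_one hs0.ne']; congr 1; ring
  rcases le_total L (δ * s ^ (q - 1)) with h | h
  · have h1 : 0 ≤ δ ^ (1 - p) * L ^ p := by positivity
    have h2 := mul_le_mul_of_nonneg_right h hs
    rw [hpow]
    linarith
  · have h1 : s ≤ (L / δ) ^ (p - 1) := by
      have h2 : s ^ (q - 1) ≤ L / δ := by rw [le_div_iff₀ hδ]; linarith
      have h3 := Real.rpow_le_rpow (by positivity) h2 hp1.le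
      rwa [← Real.rpow_mul hs, show (q - 1) * (p - 1) = 1 by linarith, Real.rpow_one] at h3
    have h2 := mul_le_mul_of_nonneg_left h1 hL
    have h3 : L * (L / δ) ^ (p - 1) = δ ^ (1 - p) * L ^ p := by
      rcases hL.eq_or_lt with rfl | hL0
      · rw [Real.zero_rpow (by linarith)]; simp
      rw [Real.div_rpow hL hδ.le, show 1 - p = -(p - 1) by ring, Real.rpow_neg hδ.le,
        show L ^ p = L ^ (p - 1) * L by rw [← Real.rpow_add_one hL0.ne']; congr 1; ring]
      field_simp
    have h4 : 0 ≤ δ * s ^ q := by positivity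
    linarith

/-- Solutions of the terminal value problem satisfy two-sided action bounds. -/
theorem IsSolution.actionBounds {N : ℕ} {M δ q T p c : ℝ} {b : Space N → ℝ → ℝ}
    {f : Space N → ℝ → Space N} {g : Space N → ℝ} {u : Space N → ℝ → ℝ}
    (hadm : Admissible M δ T b f g) (hu : IsSolution q T b f g u) (hq : 1 < q) (hδ : 0 < δ)
    (hM : 0 < M) (hp : 1 < p) (hpq : (p - 1) * q = p) (hc : 0 < c)
    (hcM : 2 * M * (c * p) ^ q ≤ c * (p - 1)) :
    ActionBounds p (δ ^ (1 - p) * 2 ^ (p - 1)) c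
      (δ ^ (1 - p) * 2 ^ (p - 1) * M ^ p + (M + 1)) T u := by
  set A := δ ^ (1 - p) * 2 ^ (p - 1) with hA
  have hA0 : 0 < A := by positivity
  have hB : M + 1 ≤ A * M ^ p + (M + 1) := by
    have : 0 ≤ A * M ^ p := by positivity
    linarith
  have hup : ∀ x y : Space N, ∀ t s : ℝ, 0 ≤ t → t < s → s ≤ T →
      u x t ≤ u y s + A * cost p ‖y - x‖ (s - t) + (A * M ^ p + (M + 1)) * (s - t) := by
    intro x y t s h0 hts hs
    have hst : 0 < s - t := sub_pos.2 hts
    set a : Space N := (s - t)⁻¹ • (y - x) with ha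
    have hna : ‖a‖ = ‖y - x‖ / (s - t) := by
      rw [ha, norm_smul, Real.norm_eq_abs, abs_of_pos (by positivity)]; ring
    have hxa : x + (s - t) • a = y := by
      rw [ha, smul_inv_smul₀ hst.ne']; abel
    -- Young's inequality with `L = M + ‖a‖` absorbs both the drift `f` and the velocity `a`.
    have h1 := hu.subsolution.le_add_of_line hu.continuousOn (a := a)
      (K := δ ^ (1 - p) * (M + ‖a‖) ^ p) (by positivity) (by
        intro z r hr ξ
        have e1 := young_le hpq hp hδ (add_nonneg hM.le (norm_nonneg a)) (norm_nonneg ξ)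
        have e2 : δ * ‖ξ‖ ^ q ≤ b z r * ‖ξ‖ ^ q := by gcongr; exact hadm.le_b z r hr
        have e3 := (abs_le.1 (abs_real_inner_le_norm (f z r) ξ)).1
        have e4 := (abs_le.1 (abs_real_inner_le_norm a ξ)).1
        have e5 := mul_le_mul_of_nonneg_right (hadm.norm_f_le z r hr) (norm_nonneg ξ)
        unfold hamiltonian
        linarith) x h0 hts hs
    rw [hxa] at h1
    refine h1.trans ?_
    have h2 : δ ^ (1 - p) * (M + ‖a‖) ^ p * (s - t) ≤
        δ ^ (1 - p) * (2 ^ (p - 1) * (M ^ p + ‖a‖ ^ p)) * (s - t) := by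
      gcongr
      exact add_rpow_le hp.le hM.le (norm_nonneg _)
    have h3 : cost p ‖y - x‖ (s - t) = (s - t) * ‖a‖ ^ p := by rw [cost, hna]
    have h4 : 0 ≤ (M + 1) * (s - t) := by positivity
    rw [h3]
    rw [hA]
    linarith
  refine ⟨hup, fun x t s h0 hts hs => ?_⟩
  refine hu.supersolution.exists_reaches hu.continuousOn hp hpq hM hc hcM ?_ hA0.le hB hup x h0
    hts hs
  intro z r hr ξ
  have e1 : b z r * ‖ξ‖ ^ q ≤ M * ‖ξ‖ ^ q := by
    gcongr; exact (le_abs_self _).trans (hadm.abs_b_le z r hr)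
  have e2 := (abs_le.1 (abs_real_inner_le_norm (f z r) ξ)).2
  have e3 := mul_le_mul_of_nonneg_right (hadm.norm_f_le z r hr) (norm_nonneg ξ)
  have e4 : ‖ξ‖ ≤ ‖ξ‖ ^ q + 1 := by
    rcases le_total ‖ξ‖ 1 with h | h
    · have : 0 ≤ ‖ξ‖ ^ q := by positivity
      linarith
    · have := Real.rpow_le_rpow_of_exponent_le h hq.le
      rw [Real.rpow_one] at this
      linarith
  have e5 := mul_le_mul_of_nonneg_left e4 hM.le
  unfold hamiltonian
  linarith

/-- The left side is of order `c ^ q` with `q > 1`, so a small `c` works; the one chosen gives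
equality. -/
theorem exists_small_action {p q M : ℝ} (hp : 1 < p) (hq : 1 < q) (hM : 0 < M) :
    ∃ c : ℝ, 0 < c ∧ 2 * M * (c * p) ^ q ≤ c * (p - 1) := by
  have hp0 : 0 < p := by linarith
  have hp1 : 0 < p - 1 := by linarith
  have hq1 : 0 < q - 1 := by linarith
  set R := (p - 1) / (2 * M * p ^ q) with hR
  have hR0 : 0 < R := by positivity
  refine ⟨R ^ (1 / (q - 1)), by positivity, ?_⟩
  set c := R ^ (1 / (q - 1)) with hc
  have hc0 : 0 < c := by positivity
  have h1 : c ^ q = R * c := by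
    rw [show q = (q - 1) + 1 by ring, Real.rpow_add_one hc0.ne', hc, ← Real.rpow_mul hR0.le,
      one_div_mul_cancel hq1.ne', Real.rpow_one]
  rw [Real.mul_rpow hc0.le hp0.le, h1, hR]
  apply le_of_eq
  have : p ^ q ≠ 0 := by positivity
  field_simp

end HJ

theorem theorem1 (M δ q T : ℝ) (hδ : 0 < δ) (hq : 1 < q) (hT : 0 < T) :
    ∃ θ : ℝ, q / (q - 1) < θ ∧
      ∀ τ : ℝ, 0 < τ → ∃ K : ℝ,
        ∀ (N : ℕ) (b : HJ.Space N → ℝ → ℝ) (f : HJ.Space N → ℝ → HJ.Space N)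
          (g : HJ.Space N → ℝ) (u : HJ.Space N → ℝ → ℝ),
          HJ.Admissible M δ T b f g → HJ.IsSolution q T b f g u →
          ∀ (x₀ x₁ : HJ.Space N), ∀ t₀ ∈ Set.Icc 0 (T - τ), ∀ t₁ ∈ Set.Icc 0 (T - τ),
            |u x₀ t₀ - u x₁ t₁| ≤
              K * (‖x₀ - x₁‖ ^ ((θ - q / (q - 1)) / (θ - 1))
                + |t₀ - t₁| ^ ((θ - q / (q - 1)) / θ)) := by
  have hq1 : 0 < q - 1 := by linarith
  -- For `M ≤ 0` no admissible data exist, since `0 < δ ≤ b ≤ M`.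
  rcases le_or_gt M 0 with hM | hM
  · refine ⟨q / (q - 1) + 1, by linarith, fun τ _ => ⟨0, ?_⟩⟩
    intro N b f g u hadm
    have ht : T / 2 ∈ Set.Ioo 0 T := ⟨by linarith, by linarith⟩
    have h1 := hadm.le_b 0 _ ht
    have h2 := (le_abs_self _).trans (hadm.abs_b_le 0 _ ht)
    linarith
  set p := q / (q - 1) with hpdef
  have hp : 1 < p := by rw [hpdef, lt_div_iff₀ hq1]; linarith
  have hpq : (p - 1) * q = p := by rw [hpdef]; field_simp; ring
  obtain ⟨c, hc, hcM⟩ := HJ.exists_small_action hp hq hM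
  obtain ⟨θ, hθ, h⟩ := HJ.exists_holder_exponent (A := δ ^ (1 - p) * 2 ^ (p - 1)) hp
    (by positivity) hc
  refine ⟨θ, hθ, fun τ hτ => ?_⟩
  obtain ⟨K, hK⟩ := h (δ ^ (1 - p) * 2 ^ (p - 1) * M ^ p + (M + 1)) M T τ (by positivity) hM.le
    hT hτ
  refine ⟨K, fun N b f g u hadm hu => hK (HJ.Space N) u
    (hu.actionBounds hadm hq hδ hM hp hpq hc hcM) fun x => ?_⟩
  rw [hu.terminal x]
  exact hadm.abs_g_le x
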